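/- Let $R$ be a nonzero associative ring with identity whose only idempotents are $0$ and $1$, let $J(R)$ be its Jacobson radical, and let $n\ge 1$ be an integer. Let $M_n(R)$ be the ring of $n\times n$ matrices over $R$, and let $M_n(J(R))$ be its ideal of matrices with all entries in $J(R)$. A ring $S$ is called nil-clean if for every $a\in S$ there is an idempotent $e\in S$ such that $a-e$ is nilpotent. Then the following are equivalent: (1) $M_n(R)$ is nil-clean; (2) $R/J(R)\cong \mathbb{Z}_2$ (the ring of integers modulo $2$), and $M_n(J(R))$ is nil, i.e. every element of it is nilpotent. -/

import Mathlib

/-- An element is nil-clean if subtracting some idempotent from it leaves a nilpotent. -/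
def IsNilCleanElem {R : Type*} [Ring R] (a : R) : Prop :=
  ∃ e : R, IsIdempotentElem e ∧ IsNilpotent (a - e)

/-- A ring is nil-clean if each of its elements is nil-clean. -/
def IsNilCleanRing (R : Type*) [Ring R] : Prop :=
  ∀ a : R, IsNilCleanElem a

/-- A ring without idempotents other than `0` and `1`. -/
def HasOnlyTrivialIdempotents (R : Type*) [Ring R] : Prop :=
  ∀ e : R, IsIdempotentElem e → e = 0 ∨ e = 1

/-- An ideal is nil if each of its elements is nilpotent. -/
def IsNilIdeal {R : Type*} [Ring R] (I : Ideal R) : Prop :=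
  ∀ x ∈ I, IsNilpotent x

/-!
If `Mₙ(R)` is nil-clean then it is an exchange ring, and the exchange property passes to its corner
`R`; an exchange ring with only trivial idempotents is local, so `R / J(R)` is a division ring `D`.
Over `D`, if `f` is idempotent and `f + φ ⊗ w` is nilpotent with `φ w ≠ 0`, then `φ w = -1`. Since
every `-(φ ⊗ w)` is an idempotent plus a nilpotent, `-1` is the only nonzero scalar, and `D` has two
elements. The radical of a nil-clean ring is nil, because an idempotent that becomes nilpotent
modulo the radical lies in the radical and is zero.

Conversely, idempotents lift modulo nil ideals, which reduces the claim to endomorphisms of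
finite-dimensional spaces over `𝔽₂`, and gluing along an invariant subspace and its quotient reduces
it to irreducible endomorphisms `T`. Such a `T` has a Newton basis `v, (T - d₀) v,
(T - d₁)(T - d₀) v, …`, and subtracting the shift of this basis from `T` leaves `diag(d)` with its
last column replaced by that of `T`. This is idempotent when the bottom entry of that column is `1`
and its entries beside a nonzero `dᵢ` vanish. If `tr T = 1`, take `d = 0`: the trace is the bottom
entry. If `tr T = 0` and `T ≠ 0, 1`, take `d = (0, 1, 0, …)`: the trace again makes the bottom entry
`1`, and surjectivity of `T` and `T - 1` determines the entry beside `d₁`.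
-/

open Module

theorem IsNilCleanRing.of_surjective {R S : Type*} [Ring R] [Ring S] (h : IsNilCleanRing R)
    (f : R →+* S) (hf : Function.Surjective f) : IsNilCleanRing S := by
  intro b
  obtain ⟨a, rfl⟩ := hf b
  obtain ⟨e, he, hq⟩ := h a
  exact ⟨f e, he.map f, by simpa using hq.map f⟩

theorem IsNilCleanRing.of_surjective_of_nil_ker {R S : Type*} [Ring R] [Ring S]
    (h : IsNilCleanRing S) (f : R →+* S) (hf : Function.Surjective f)
    (hker : ∀ x ∈ RingHom.ker f, IsNilpotent x) : IsNilCleanRing R := by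
  intro a
  obtain ⟨e, he, k, hk⟩ := h (f a)
  obtain ⟨e', he', rfl⟩ := exists_isIdempotentElem_eq_of_ker_isNilpotent f hker e (hf e) he
  have hmem : (a - e') ^ k ∈ RingHom.ker f := by rwa [RingHom.mem_ker, map_pow, map_sub]
  exact ⟨e', he', (hker _ hmem).of_pow⟩

theorem eq_zero_of_isIdempotentElem_of_mem_jacobson {R : Type*} [Ring R] {e : R}
    (he : IsIdempotentElem e) (hJ : e ∈ Ring.jacobson R) : e = 0 := by
  obtain ⟨s, hs⟩ := Ideal.exists_mul_sub_mem_of_sub_one_mem_jacobson (I := ⊥) (1 - e)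
    (by simpa [Ideal.jacobson_bot] using hJ)
  calc e = s * (1 - e) * e := by rw [sub_eq_zero.1 (Ideal.mem_bot.1 hs), one_mul]
    _ = 0 := by rw [mul_assoc, he.one_sub_mul_self, mul_zero]

theorem IsNilCleanRing.isNilIdeal_jacobson {R : Type*} [Ring R] (h : IsNilCleanRing R) :
    IsNilIdeal (Ring.jacobson R) := by
  intro a ha
  obtain ⟨e, he, hq⟩ := h a
  have hmem : e ∈ Ring.jacobson R := by
    rw [← Ideal.Quotient.eq_zero_iff_mem] at ha ⊢
    have hneg := hq.map (Ideal.Quotient.mk (Ring.jacobson R))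
    rw [map_sub, ha, zero_sub, isNilpotent_neg_iff] at hneg
    exact (he.map _).eq_zero_of_isNilpotent hneg
  rwa [eq_zero_of_isIdempotentElem_of_mem_jacobson he hmem, sub_zero] at hq

theorem IsNilCleanRing.isNilIdeal_matrix_jacobson {R ι : Type*} [Ring R] [Fintype ι]
    [DecidableEq ι] (h : IsNilCleanRing (Matrix ι ι R)) :
    IsNilIdeal ((Ring.jacobson R).matrix ι) := by
  intro x hx
  apply h.isNilIdeal_jacobson
  rw [← Ideal.jacobson_bot] at hx ⊢
  simpa only [Ideal.matrix_bot] using Ideal.matrix_jacobson_le ⊥ hx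

/-- An exchange ring, in the form of the Goodearl–Nicholson criterion: for each `a` there is an
idempotent `e ∈ aR` with `1 - e ∈ (1 - a)R`. In a noncommutative ring `a ∣ e` means `e ∈ aR`. -/
def IsExchangeRing (R : Type*) [Ring R] : Prop :=
  ∀ a : R, ∃ e : R, IsIdempotentElem e ∧ a ∣ e ∧ 1 - a ∣ 1 - e

theorem IsNilCleanRing.isExchangeRing {R : Type*} [Ring R] (h : IsNilCleanRing R) :
    IsExchangeRing R := by
  intro a
  obtain ⟨e, he, hq⟩ := h (a - 1)
  obtain ⟨u, hu⟩ : IsUnit (a - e) := by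
    simpa only [sub_right_comm a 1 e, add_sub_cancel] using hq.isUnit_one_add
  have ha : a = e + u := by rw [hu, add_sub_cancel]
  have hconj : u * (1 - e) * (↑u⁻¹ : R) = a - (a * a - a) * (↑u⁻¹ : R) := by
    rw [Units.mul_inv_eq_iff_eq_mul, sub_mul, Units.inv_mul_cancel_right, ha]
    simp only [mul_sub, mul_add, add_mul, he.eq]
    noncomm_ring
  refine ⟨u * (1 - e) * (↑u⁻¹ : R), ?_, ⟨1 - (a - 1) * (↑u⁻¹ : R), ?_⟩,
    ⟨1 - a * (↑u⁻¹ : R), ?_⟩⟩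
  · calc u * (1 - e) * (↑u⁻¹ : R) * (u * (1 - e) * (↑u⁻¹ : R))
        = u * ((1 - e) * (1 - e)) * (↑u⁻¹ : R) := by
          simp only [mul_assoc, Units.inv_mul_cancel_left]
      _ = u * (1 - e) * (↑u⁻¹ : R) := by rw [he.one_sub.eq]
  · rw [hconj]; noncomm_ring
  · rw [hconj]; noncomm_ring

theorem IsExchangeRing.of_matrix {R ι : Type*} [Ring R] [Fintype ι] [DecidableEq ι] [Nonempty ι]
    (h : IsExchangeRing (Matrix ι ι R)) : IsExchangeRing R := by
  intro a
  obtain ⟨i⟩ := ‹Nonempty ι›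
  obtain ⟨F, hF, ⟨S, hS⟩, ⟨T, hT⟩⟩ := h (Matrix.single i i a)
  have hrow : ∀ j, j ≠ i → F j i = 0 := fun j hj => by
    rw [hS, Matrix.single_mul_apply_of_ne _ _ _ _ _ hj]
  refine ⟨F i i, ?_, ⟨S i i, ?_⟩, ⟨T i i, ?_⟩⟩
  · calc F i i * F i i = (F * F) i i := by
          rw [Matrix.mul_apply, Fintype.sum_eq_single i fun j hj => by rw [hrow j hj, mul_zero]]
      _ = F i i := by rw [hF.eq]
  · rw [hS, Matrix.single_mul_apply_same]
  · simpa [sub_mul] using congrFun (congrFun hT i) i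

theorem HasOnlyTrivialIdempotents.isDedekindFiniteMonoid {R : Type*} [Ring R]
    (hR : HasOnlyTrivialIdempotents R) : IsDedekindFiniteMonoid R where
  mul_eq_one_symm {x y} hxy := by
    have hyx : IsIdempotentElem (y * x) := by
      rw [IsIdempotentElem, mul_assoc, ← mul_assoc x, hxy, one_mul]
    refine (hR _ hyx).elim (fun h0 => ?_) id
    have hzero : (1 : R) = 0 := by
      calc (1 : R) = x * (y * x) * y := by rw [← mul_assoc, hxy, one_mul, hxy]
        _ = 0 := by rw [h0, mul_zero, zero_mul]
    exact (subsingleton_of_zero_eq_one hzero.symm).elim _ _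

theorem IsExchangeRing.isLocalRing {R : Type*} [Ring R] [Nontrivial R] (h : IsExchangeRing R)
    (hR : HasOnlyTrivialIdempotents R) : IsLocalRing R := by
  have := hR.isDedekindFiniteMonoid
  refine .of_isUnit_or_isUnit_one_sub_self fun x => ?_
  obtain ⟨e, he, ⟨s, hs⟩, ⟨t, ht⟩⟩ := h x
  rcases hR e he with rfl | rfl
  · exact .inr (.of_mul_eq_one t (by rw [← ht, sub_zero]))
  · exact .inl (.of_mul_eq_one s hs.symm)

theorem isUnit_of_notMem_jacobson {R : Type*} [Ring R] [IsLocalRing R] [IsDedekindFiniteMonoid R]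
    {x : R} (hx : x ∉ Ring.jacobson R) : IsUnit x := by
  simp only [← Ideal.jacobson_bot, Ideal.mem_jacobson_iff, Ideal.mem_bot, sub_eq_zero, not_forall,
    not_exists] at hx
  obtain ⟨y, hy⟩ := hx
  have hnot : ¬ IsUnit (y * x + 1) := by
    rintro ⟨u, hu⟩
    exact hy ↑u⁻¹ (by rw [mul_assoc, ← mul_add_one, ← hu, u.inv_mul])
  obtain ⟨u, hu⟩ : IsUnit (-(y * x)) :=
    (IsLocalRing.isUnit_or_isUnit_of_add_one (neg_add_cancel_left (y * x) 1)).resolve_right hnot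
  have hleft : (↑u⁻¹ * -y) * x = 1 := by rw [mul_assoc, neg_mul, ← hu, u.inv_mul]
  exact .of_mul_eq_one _ (mul_eq_one_symm hleft)

section DivisionRing

variable {K V : Type*} [DivisionRing K] [AddCommGroup V] [Module K V]

theorem eq_zero_of_isNilpotent_of_apply_eq_smul {N : End K V} (hN : IsNilpotent N) {r : K} {x : V}
    (hx : x ≠ 0) (h : N x = r • x) : r = 0 := by
  have hpow (k : ℕ) : (N ^ k) x = r ^ k • x := by
    induction k with
    | zero => simp
    | succ k ih => rw [pow_succ, End.mul_apply, h, map_smul, ih, smul_smul, pow_succ']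
  obtain ⟨k, hk⟩ := hN
  have hr : r ^ k • x = 0 := by rw [← hpow, hk, LinearMap.zero_apply]
  exact eq_zero_of_pow_eq_zero ((smul_eq_zero.1 hr).resolve_right hx)

theorem pow_finrank_apply_eq_zero {N : End K V} (hN : IsNilpotent N) {W : Submodule K V}
    [FiniteDimensional K W] (hW : ∀ x ∈ W, N x ∈ W) {x : V} (hx : x ∈ W) :
    (N ^ finrank K W) x = 0 := by
  obtain ⟨k, hk⟩ := hN
  have hker : (⟨x, hx⟩ : W) ∈ LinearMap.ker (N.restrict hW ^ k) := by
    rw [LinearMap.mem_ker, End.pow_restrict]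
    exact Subtype.ext (by simp [hk])
  have hfin := LinearMap.mem_ker.1 (End.ker_pow_le_ker_pow_finrank _ k hker)
  rw [End.pow_restrict] at hfin
  exact congrArg Subtype.val hfin

theorem apply_apply_eq_zero_of_mem_span_pair {N : End K V} (hN : IsNilpotent N) {v w : V}
    (hv : N v ∈ Submodule.span K {v, w}) (hw : N w ∈ Submodule.span K {v, w}) :
    N (N v) = 0 := by
  have := FiniteDimensional.span_of_finite K (Set.toFinite {v, w})
  have hW : Submodule.span K {v, w} ≤ (Submodule.span K {v, w}).comap N := by
    rw [Submodule.span_le, Set.pair_subset_iff]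
    exact ⟨hv, hw⟩
  have hfin : finrank K (Submodule.span K {v, w}) ≤ 2 := by
    classical
    exact_mod_cast (finrank_span_finset_le_card (R := K) {v, w}).trans Finset.card_le_two
  have hpow := pow_finrank_apply_eq_zero hN hW (Submodule.subset_span (Set.mem_insert v _))
  exact End.pow_map_zero_of_le hfin hpow

theorem exists_apply_eq_self_of_isNilpotent_add_smulRight {f : End K V}
    (hf : IsIdempotentElem f) {φ : V →ₗ[K] K} {w : V} (hN : IsNilpotent (f + φ.smulRight w))
    (hw : φ w ≠ 0) : ∃ v, f v = v ∧ φ v = 1 ∧ ∀ x, f x = φ (f x) • v := by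
  have hff (x : V) : f (f x) = f x := LinearMap.congr_fun hf x
  have hinj (x : V) (hx : f x = x) (hφ : φ x = 0) : x = 0 := by
    by_contra hx0
    exact one_ne_zero (eq_zero_of_isNilpotent_of_apply_eq_smul hN (r := 1) hx0 (by simp [hx, hφ]))
  obtain ⟨x, hx⟩ : ∃ x, f x ≠ 0 := by
    by_contra! hf0
    have hw0 : w ≠ 0 := fun h => hw (by rw [h, map_zero])
    exact hw (eq_zero_of_isNilpotent_of_apply_eq_smul hN hw0 (by simp [hf0]))
  have hφx : φ (f x) ≠ 0 := fun h => hx (hinj _ (hff x) h)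
  have hv : f ((φ (f x))⁻¹ • f x) = (φ (f x))⁻¹ • f x := by rw [map_smul, hff]
  have hφv : φ ((φ (f x))⁻¹ • f x) = 1 := by rw [map_smul, smul_eq_mul, inv_mul_cancel₀ hφx]
  refine ⟨_, hv, hφv, fun y => sub_eq_zero.1 (hinj _ ?_ ?_)⟩
  · rw [map_sub, hff, map_smul, hv]
  · rw [map_sub, map_smul, hφv, smul_eq_mul, mul_one, sub_self]

theorem eq_neg_one_of_isNilpotent_add_smulRight {f : End K V} (hf : IsIdempotentElem f)
    {φ : V →ₗ[K] K} {w : V} (hN : IsNilpotent (f + φ.smulRight w)) (hw : φ w ≠ 0) :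
    φ w = -1 := by
  obtain ⟨v, hv, hφv, hfv⟩ := exists_apply_eq_self_of_isNilpotent_add_smulRight hf hN hw
  set N := f + φ.smulRight w with hNdef
  have hNv : N v = v + w := by simp [hNdef, hv, hφv]
  have hNw : N w = φ (f w) • v + φ w • w := by simp [hNdef, ← hfv w]
  -- `N` preserves the plane spanned by `v` and `w`, so its square vanishes there.
  have hrel : (1 + φ (f w)) • v + (1 + φ w) • w = 0 := by
    have hNN : N (N v) = 0 := apply_apply_eq_zero_of_mem_span_pair hN
      (Submodule.mem_span_pair.2 ⟨1, 1, by simp [hNv]⟩)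
      (Submodule.mem_span_pair.2 ⟨_, _, hNw.symm⟩)
    rw [← hNN, hNv, map_add, hNv, hNw, add_smul, add_smul, one_smul, one_smul]
    abel
  by_contra hne
  have h1w : 1 + φ w ≠ 0 := fun h => hne (eq_neg_of_add_eq_zero_right h)
  obtain ⟨a, rfl⟩ : ∃ a : K, w = a • v :=
    ⟨(1 + φ w)⁻¹ * -(1 + φ (f w)), by
      rw [mul_smul, neg_smul, ← eq_neg_of_add_eq_zero_right hrel, inv_smul_smul₀ h1w]⟩
  have ha : φ (a • v) = a := by rw [map_smul, hφv, smul_eq_mul, mul_one]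
  have hv0 : v ≠ 0 := by rintro rfl; simp at hφv
  rw [ha] at h1w
  exact h1w (eq_zero_of_isNilpotent_of_apply_eq_smul hN hv0 (by rw [hNv, add_smul, one_smul]))

theorem nonempty_ringEquiv_zmod_two_of_forall_eq_zero_or_one (h : ∀ c : K, c = 0 ∨ c = 1) :
    Nonempty (K ≃+* ZMod 2) := by
  classical
  let _ : Fintype K := ⟨{0, 1}, fun c => by simpa using h c⟩
  have hcard : Fintype.card K = 2 := Finset.card_pair zero_ne_one
  exact ⟨(ZMod.ringEquivOfPrime K Nat.prime_two hcard).symm⟩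

theorem IsNilCleanRing.nonempty_ringEquiv_zmod_two_of_end [Nontrivial V]
    (h : IsNilCleanRing (End K V)) : Nonempty (K ≃+* ZMod 2) := by
  obtain ⟨w, hw⟩ := exists_ne (0 : V)
  obtain ⟨φ, hφ⟩ := Projective.exists_dual_ne_zero K hw
  have hneg (c : K) (hc : c ≠ 0) : c = -1 := by
    set x := (c * (φ w)⁻¹) • w with hx
    have hφx : φ x = c := by rw [hx, map_smul, smul_eq_mul, inv_mul_cancel_right₀ hφ]
    obtain ⟨f, hf, hq⟩ := h (-φ.smulRight x)
    rw [← isNilpotent_neg_iff, neg_sub, sub_neg_eq_add] at hq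
    rw [← hφx] at hc ⊢
    exact eq_neg_one_of_isNilpotent_add_smulRight hf hq hc
  refine nonempty_ringEquiv_zmod_two_of_forall_eq_zero_or_one fun c => ?_
  exact or_iff_not_imp_left.2 fun hc => (hneg c hc).trans (hneg 1 one_ne_zero).symm

end DivisionRing

/-- Left multiplication identifies `n × n` matrices over a ring with the endomorphisms of the
*right* module of column vectors, that is, of a left module over the opposite ring. -/
def matrixRingEquivEnd (R ι : Type*) [Ring R] [Fintype ι] [DecidableEq ι] :
    Matrix ι ι R ≃+* End Rᵐᵒᵖ (ι → R) :=
  (RingEquiv.moduleEndSelfOp R).mapMatrix.trans (endVecRingEquivMatrixEnd ι Rᵐᵒᵖ R).symm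

theorem IsNilCleanRing.nonempty_ringEquiv_zmod_two_of_matrix {D ι : Type*} [DivisionRing D]
    [Fintype ι] [DecidableEq ι] [Nonempty ι] (h : IsNilCleanRing (Matrix ι ι D)) :
    Nonempty (D ≃+* ZMod 2) := by
  have hEnd : IsNilCleanRing (End Dᵐᵒᵖ (ι → D)) :=
    h.of_surjective (matrixRingEquivEnd D ι).toRingHom (matrixRingEquivEnd D ι).surjective
  obtain ⟨e⟩ := hEnd.nonempty_ringEquiv_zmod_two_of_end
  exact ⟨(RingEquiv.opOp D).trans (e.op.trans (RingEquiv.toOpposite (ZMod 2)).symm)⟩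

theorem mapMatrix_surjective {R S ι : Type*} [Ring R] [Ring S] [Fintype ι] [DecidableEq ι]
    {f : R →+* S} (hf : Function.Surjective f) :
    Function.Surjective (f.mapMatrix : Matrix ι ι R →+* Matrix ι ι S) := by
  intro A
  choose B hB using fun i j => hf (A i j)
  exact ⟨Matrix.of B, by ext i j; exact hB i j⟩

theorem IsNilCleanRing.nonempty_quotient_jacobson_ringEquiv_zmod_two {R ι : Type*} [Ring R]
    [Nontrivial R] [Fintype ι] [DecidableEq ι] [Nonempty ι] (h : IsNilCleanRing (Matrix ι ι R))
    (hR : HasOnlyTrivialIdempotents R) : Nonempty ((R ⧸ Ring.jacobson R) ≃+* ZMod 2) := by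
  have := hR.isDedekindFiniteMonoid
  have := h.isExchangeRing.of_matrix.isLocalRing hR
  have : Nontrivial (R ⧸ Ring.jacobson R) :=
    Ideal.Quotient.nontrivial_iff.2 (Ring.jacobson_lt_top R).ne
  have hunit (a : R ⧸ Ring.jacobson R) : IsUnit a ∨ a = 0 := by
    obtain ⟨x, rfl⟩ := Ideal.Quotient.mk_surjective a
    by_cases hx : x ∈ Ring.jacobson R
    · exact .inr (Ideal.Quotient.eq_zero_iff_mem.2 hx)
    · exact .inl ((isUnit_of_notMem_jacobson hx).map _)
  let _ : DivisionRing (R ⧸ Ring.jacobson R) := .ofIsUnitOrEqZero hunit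
  exact (h.of_surjective _ (mapMatrix_surjective
    Ideal.Quotient.mk_surjective)).nonempty_ringEquiv_zmod_two_of_matrix

section Ring

variable {K V : Type*} [Ring K] [AddCommGroup V] [Module K V]

theorem isNilpotent_of_basis_shift {n : ℕ} (b : Basis (Fin (n + 1)) K V) {N : End K V}
    (hsucc : ∀ i : Fin n, N (b i.castSucc) = b i.succ) (hlast : N (b (Fin.last n)) = 0) :
    IsNilpotent N := by
  have hpow (k : ℕ) : ∀ i : Fin (n + 1), n < i + k → (N ^ k) (b i) = 0 := by
    induction k with
    | zero => exact fun i hi => absurd i.2 (by omega)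
    | succ k ih =>
      intro i hi
      rw [pow_succ, End.mul_apply]
      induction i using Fin.lastCases with
      | last => rw [hlast, map_zero]
      | cast i =>
        rw [hsucc]
        exact ih _ (by rw [Fin.val_succ]; rw [Fin.val_castSucc] at hi; omega)
  exact ⟨n + 1, b.ext fun i => hpow _ i (by omega)⟩

/-- In the basis `b`, the endomorphism `T` has a companion matrix shifted along the diagonal:
diagonal entries `d 0, d 1, …`, ones below the diagonal, and an arbitrary last column. Only the
first `n` values of `d` matter. -/
def IsShiftedCompanion (T : End K V) (d : ℕ → K) {n : ℕ} (b : Basis (Fin (n + 1)) K V) : Prop :=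
  ∀ i : Fin n, T (b i.castSucc) = d i • b i.castSucc + b i.succ

theorem IsShiftedCompanion.isNilCleanElem {T : End K V} {d : ℕ → K} {n : ℕ}
    {b : Basis (Fin (n + 1)) K V} (hT : IsShiftedCompanion T d b)
    (hd : ∀ i : Fin n, IsIdempotentElem (d i))
    (hlast : b.coord (Fin.last n) (T (b (Fin.last n))) = 1)
    (hcol : ∀ i : Fin n, b.coord i.castSucc (T (b (Fin.last n))) * d i = 0) :
    IsNilCleanElem T := by
  obtain ⟨N, hN⟩ : ∃ N : End K V, ∀ i, N (b i) = Fin.lastCases 0 (fun i => b i.succ) i :=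
    ⟨b.constr ℕ _, b.constr_basis ℕ _⟩
  have hNsucc (i : Fin n) : N (b i.castSucc) = b i.succ := by rw [hN, Fin.lastCases_castSucc]
  have hNlast : N (b (Fin.last n)) = 0 := by rw [hN, Fin.lastCases_last]
  have hEsucc (i : Fin n) : (T - N) (b i.castSucc) = d i • b i.castSucc := by
    rw [LinearMap.sub_apply, hT, hNsucc, add_sub_cancel_right]
  have hElast : (T - N) (b (Fin.last n)) = T (b (Fin.last n)) := by
    rw [LinearMap.sub_apply, hNlast, sub_zero]
  refine ⟨T - N, b.ext fun i => ?_, ?_⟩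
  · rw [End.mul_apply]
    induction i using Fin.lastCases with
    | cast i => rw [hEsucc, map_smul, hEsucc, smul_smul, (hd i).eq]
    | last =>
      rw [hElast]
      conv_lhs => rw [← b.sum_repr (T (b (Fin.last n)))]
      simp only [Basis.coord_apply] at hlast hcol
      simp only [Fin.sum_univ_castSucc, map_add, map_sum, map_smul, hEsucc, hElast, smul_smul,
        hcol, hlast, zero_smul, Finset.sum_const_zero, zero_add, one_smul]
  · rw [sub_sub_cancel]
    exact isNilpotent_of_basis_shift b hNsucc hNlast

/-- The vectors `(T - d (j - 1)) ⋯ (T - d 0) v`, which form a Newton basis when `T` is irreducible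
and `v ≠ 0`. -/
def newtonSeq (T : End K V) (d : ℕ → K) (v : V) : ℕ → V
  | 0 => v
  | j + 1 => T (newtonSeq T d v j) - d j • newtonSeq T d v j

theorem apply_newtonSeq (T : End K V) (d : ℕ → K) (v : V) (j : ℕ) :
    T (newtonSeq T d v j) = d j • newtonSeq T d v j + newtonSeq T d v (j + 1) :=
  (add_sub_cancel _ _).symm

/-- An endomorphism is irreducible if it has no invariant submodules other than `⊥` and `⊤`. -/
def IsIrreducibleEnd (T : End K V) : Prop :=
  ∀ W ∈ T.invtSubmodule, W = ⊥ ∨ W = ⊤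

theorem IsIrreducibleEnd.surjective_of_commute {T S : End K V} (hT : IsIrreducibleEnd T)
    (hS : S ≠ 0) (hcomm : Commute T S) : Function.Surjective S := by
  have hinv : LinearMap.range S ∈ T.invtSubmodule := by
    rintro _ ⟨x, rfl⟩
    exact ⟨T x, (LinearMap.congr_fun hcomm x).symm⟩
  refine LinearMap.range_eq_top.1 ((hT _ hinv).resolve_left fun h => hS ?_)
  exact LinearMap.range_eq_bot.1 h

theorem apply_basis_ne_zero_of_surjective {ι W : Type*} [AddCommGroup W] [Module K W]
    (b : Basis ι K V) {f : V →ₗ[K] W} (hf : Function.Surjective f) {χ : W →ₗ[K] K} (hχ : χ ≠ 0)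
    {j : ι} (h : ∀ i, i ≠ j → χ (f (b i)) = 0) : χ (f (b j)) ≠ 0 := by
  intro hj
  have hcomp : χ ∘ₗ f = 0 := b.ext fun i => by
    by_cases hi : i = j
    · rw [hi]; exact hj
    · exact h i hi
  refine hχ (LinearMap.ext fun y => ?_)
  obtain ⟨x, rfl⟩ := hf y
  exact LinearMap.congr_fun hcomp x

theorem IsShiftedCompanion.coord_zero_apply_last_ne_zero [Nontrivial K] {T : End K V} {d : ℕ → K}
    {n : ℕ} {b : Basis (Fin (n + 1)) K V} (hT : IsShiftedCompanion T d b) (hd : d 0 = 0)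
    (hsurj : Function.Surjective T) : b.coord 0 (T (b (Fin.last n))) ≠ 0 := by
  have hcoord : b.coord 0 ≠ 0 := fun h =>
    one_ne_zero (α := K) (by simpa using LinearMap.congr_fun h (b 0))
  refine apply_basis_ne_zero_of_surjective b hsurj hcoord fun i hi => ?_
  obtain ⟨i, rfl⟩ := Fin.exists_castSucc_eq.2 hi
  by_cases hi0 : (i : ℕ) = 0 <;> simp [hT i, Fin.ext_iff, hi0, hd]

end Ring

theorem IsShiftedCompanion.trace_eq {K V : Type*} [CommRing K] [AddCommGroup V] [Module K V]
    {T : End K V} {d : ℕ → K} {n : ℕ} {b : Basis (Fin (n + 1)) K V}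
    (hT : IsShiftedCompanion T d b) :
    LinearMap.trace K V T =
      ∑ i : Fin n, d i + b.coord (Fin.last n) (T (b (Fin.last n))) := by
  have hdiag (i : Fin n) : b.repr (T (b i.castSucc)) i.castSucc = d i := by
    rw [hT, map_add, map_smul, Finsupp.add_apply, Finsupp.smul_apply, b.repr_self, b.repr_self,
      Finsupp.single_eq_same, Finsupp.single_eq_of_ne (Fin.castSucc_lt_succ).ne, smul_eq_mul,
      mul_one, add_zero]
  simp only [LinearMap.trace_eq_matrix_trace K b, Matrix.trace, Matrix.diag_apply,
    LinearMap.toMatrix_apply, Fin.sum_univ_castSucc, hdiag, Basis.coord_apply]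

section DivisionRing

variable {K V : Type*} [DivisionRing K] [AddCommGroup V] [Module K V]

theorem IsIrreducibleEnd.linearIndependent_newtonSeq [FiniteDimensional K V] {T : End K V}
    (hT : IsIrreducibleEnd T) (d : ℕ → K) {v : V} (hv : v ≠ 0) {k : ℕ} (hk : k ≤ finrank K V) :
    LinearIndependent K fun i : Fin k => newtonSeq T d v i := by
  induction k with
  | zero => exact linearIndependent_empty_type
  | succ k ih =>
    refine linearIndependent_finSucc'.2 ⟨ih (by omega), fun hmem => ?_⟩
    set W := Submodule.span K (Set.range fun i : Fin k => newtonSeq T d v i) with hWdef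
    have hseq : ∀ j ≤ k, newtonSeq T d v j ∈ W := by
      intro j hj
      rcases hj.lt_or_eq with hj | rfl
      · exact Submodule.subset_span ⟨⟨j, hj⟩, rfl⟩
      · exact hmem
    have hinv : W ∈ T.invtSubmodule := by
      rw [End.mem_invtSubmodule, hWdef, Submodule.span_le]
      rintro _ ⟨i, rfl⟩
      change T (newtonSeq T d v i) ∈ W
      rw [apply_newtonSeq]
      exact add_mem (W.smul_mem _ (hseq i i.2.le)) (hseq _ i.2)
    have hbot : W ≠ ⊥ := fun h => hv ((Submodule.mem_bot K).1 (h ▸ hseq 0 k.zero_le))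
    have hcard := finrank_range_le_card (R := K) fun i : Fin k => newtonSeq T d v i
    rw [Set.finrank, ← hWdef, (hT W hinv).resolve_left hbot, finrank_top, Fintype.card_fin] at hcard
    omega

theorem IsIrreducibleEnd.exists_isShiftedCompanion [FiniteDimensional K V] [Nontrivial V]
    {T : End K V} (hT : IsIrreducibleEnd T) (d : ℕ → K) :
    ∃ (n : ℕ) (b : Basis (Fin (n + 1)) K V), IsShiftedCompanion T d b := by
  obtain ⟨v, hv⟩ := exists_ne (0 : V)
  obtain ⟨n, hn⟩ := Nat.exists_eq_succ_of_ne_zero (finrank_pos (R := K) (M := V)).ne'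
  refine ⟨n, basisOfLinearIndependentOfCardEqFinrank
    (hT.linearIndependent_newtonSeq d hv hn.ge) (by simp [hn]), fun i => ?_⟩
  simp only [coe_basisOfLinearIndependentOfCardEqFinrank, Fin.val_castSucc, Fin.val_succ,
    apply_newtonSeq T d v i]

theorem isNilpotent_of_restrict_of_mapQ {N : End K V} {W : Submodule K V}
    (hW : W ≤ W.comap N) (h₁ : IsNilpotent (N.restrict hW)) (h₂ : IsNilpotent (W.mapQ W N hW)) :
    IsNilpotent N := by
  obtain ⟨k, hk⟩ := h₁
  obtain ⟨l, hl⟩ := h₂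
  refine ⟨k + l, LinearMap.ext fun x => ?_⟩
  have hmem : (N ^ l) x ∈ W := by
    rw [← W.mapQ_pow hW l (W.le_comap_pow_of_le_comap hW l)] at hl
    exact (Submodule.Quotient.mk_eq_zero W).1 (LinearMap.congr_fun hl (W.mkQ x))
  rw [End.pow_restrict] at hk
  rw [pow_add, End.mul_apply]
  exact congrArg Subtype.val (LinearMap.congr_fun hk ⟨_, hmem⟩)

theorem exists_isIdempotentElem_restrict_eq_mapQ_eq {W : Submodule K V} {E₁ : End K W}
    {E₂ : End K (V ⧸ W)} (h₁ : IsIdempotentElem E₁) (h₂ : IsIdempotentElem E₂) :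
    ∃ (E : End K V) (hE : W ≤ W.comap E),
      IsIdempotentElem E ∧ E.restrict hE = E₁ ∧ W.mapQ W E hE = E₂ := by
  obtain ⟨C, hC⟩ := W.exists_isCompl
  let e := W.quotientEquivOfIsCompl C hC
  let s : V ⧸ W →ₗ[K] V := C.subtype ∘ₗ e
  have hs (y : V ⧸ W) : W.mkQ (s y) = y := Submodule.mk_quotientEquivOfIsCompl_apply hC y
  have hdecomp (x : V) : ∃ (w : W) (y : V ⧸ W), x = w + s y := by
    obtain ⟨w, c, rfl, -⟩ := Submodule.existsUnique_add_of_isCompl hC x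
    exact ⟨w, e.symm c, by simp [s]⟩
  let E : End K V := LinearMap.ofIsCompl hC (W.subtype ∘ₗ E₁) (s ∘ₗ E₂ ∘ₗ e.symm)
  have hEW (w : W) : E w = E₁ w := LinearMap.ofIsCompl_apply_left hC w
  have hEs (y : V ⧸ W) : E (s y) = s (E₂ y) :=
    (LinearMap.ofIsCompl_apply_right hC (e y)).trans (by simp)
  refine ⟨E, fun w hw => ?_, LinearMap.ext fun x => ?_, ?_, ?_⟩
  · rw [Submodule.mem_comap, hEW ⟨w, hw⟩]
    exact (E₁ _).2
  · obtain ⟨w, y, rfl⟩ := hdecomp x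
    have h₁w : E₁ (E₁ w) = E₁ w := LinearMap.congr_fun h₁ w
    have h₂y : E₂ (E₂ y) = E₂ y := LinearMap.congr_fun h₂ y
    simp only [End.mul_apply, map_add, hEW, hEs, h₁w, h₂y]
  · exact LinearMap.ext fun w => Subtype.ext (hEW w)
  · refine LinearMap.ext fun y => ?_
    calc W.mapQ W E _ y = W.mapQ W E _ (W.mkQ (s y)) := by rw [hs]
      _ = W.mkQ (s (E₂ y)) := by rw [Submodule.mkQ_apply, Submodule.mapQ_apply, hEs]; rfl
      _ = E₂ y := hs _

theorem IsNilCleanElem.of_restrict_of_mapQ {T : End K V} {W : Submodule K V}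
    (hW : W ≤ W.comap T) (h₁ : IsNilCleanElem (T.restrict hW))
    (h₂ : IsNilCleanElem (W.mapQ W T hW)) : IsNilCleanElem T := by
  obtain ⟨E₁, hE₁, hN₁⟩ := h₁
  obtain ⟨E₂, hE₂, hN₂⟩ := h₂
  obtain ⟨E, hEW, hE, rfl, rfl⟩ := exists_isIdempotentElem_restrict_eq_mapQ_eq hE₁ hE₂
  have hsub : W ≤ W.comap (T - E) := fun _ hx => W.sub_mem (hW hx) (hEW hx)
  refine ⟨E, hE, isNilpotent_of_restrict_of_mapQ hsub hN₁ ?_⟩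
  have hmapQ : W.mapQ W (T - E) hsub = W.mapQ W T hW - W.mapQ W E hEW :=
    Submodule.linearMap_qext _ rfl
  rwa [hmapQ]

end DivisionRing

section ZModTwo

variable {V : Type*} [AddCommGroup V] [Module (ZMod 2) V]

theorem IsShiftedCompanion.coord_one_apply_last {T : End (ZMod 2) V} {n : ℕ}
    {b : Basis (Fin (n + 2)) (ZMod 2) V} (hT : IsShiftedCompanion T (Pi.single 1 1) b)
    (hsurj : Function.Surjective T) (hsurj_sub_one : Function.Surjective (T - 1 : End (ZMod 2) V)) :
    b.coord 1 (T (b (Fin.last (n + 1)))) = b.coord 1 (b (Fin.last (n + 1))) := by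
  have h0 : b.coord 0 (T (b (Fin.last (n + 1)))) = 1 :=
    Fin.eq_one_of_ne_zero _ (hT.coord_zero_apply_last_ne_zero (by simp) hsurj)
  have hsum : (b.coord 0 + b.coord 1) ((T - 1 : End (ZMod 2) V) (b (Fin.last (n + 1)))) = 1 := by
    refine Fin.eq_one_of_ne_zero _
      (apply_basis_ne_zero_of_surjective b hsurj_sub_one ?_ fun i hi => ?_)
    · exact fun h => one_ne_zero (α := ZMod 2) (by simpa using LinearMap.congr_fun h (b 0))
    · -- `T - 1` sends `b 0, b 1, b 2, …` to `b 1 - b 0, b 2, b 3 - b 2, …`, on which the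
      -- coordinates `0` and `1` sum to zero.
      obtain ⟨i, rfl⟩ := Fin.exists_castSucc_eq.2 hi
      rw [LinearMap.sub_apply, hT]
      cases i using Fin.cases with
      | zero => simp [CharTwo.add_self_eq_zero]
      | succ i => by_cases hi0 : (i : ℕ) = 0 <;> simp [Fin.ext_iff, hi0]
  have hlast : b.coord 0 (b (Fin.last (n + 1))) = 0 := by simp
  rw [LinearMap.sub_apply, map_sub, LinearMap.add_apply, LinearMap.add_apply, End.one_apply, h0,
    hlast, zero_add, add_sub_assoc, add_eq_left, sub_eq_zero] at hsum
  exact hsum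

theorem IsShiftedCompanion.isNilCleanElem_of_trace_eq_zero {T : End (ZMod 2) V} {n : ℕ}
    {b : Basis (Fin (n + 2)) (ZMod 2) V} (hT : IsShiftedCompanion T (Pi.single 1 1) b)
    (hsurj : Function.Surjective T) (hsurj_sub_one : Function.Surjective (T - 1 : End (ZMod 2) V))
    (htr : LinearMap.trace (ZMod 2) V T = 0) : IsNilCleanElem T := by
  have hone := hT.coord_one_apply_last hsurj hsurj_sub_one
  have htrace := hT.trace_eq
  refine hT.isNilCleanElem (fun i => ?_) ?_ fun i => ?_
  · by_cases hi : (i : ℕ) = 1 <;> simp [hi, IsIdempotentElem]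
  · cases n with
    | zero => simpa using hone
    | succ n =>
      rw [htr, Fin.sum_univ_eq_sum_range, Finset.sum_pi_single', if_pos (by simp)] at htrace
      exact (eq_neg_of_add_eq_zero_right htrace.symm).trans (ZMod.neg_eq_self_mod_two 1)
  · by_cases hi : i.castSucc = 1
    · rw [hi, hone]
      have hlast : Fin.last (n + 1) ≠ 1 := hi ▸ (Fin.castSucc_lt_last i).ne'
      simp [hlast]
    · rw [Pi.single_eq_of_ne (fun h : (i : ℕ) = 1 => hi (Fin.ext h)), mul_zero]

theorem IsIrreducibleEnd.isNilCleanElem_of_trace_eq_one [FiniteDimensional (ZMod 2) V]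
    [Nontrivial V] {T : End (ZMod 2) V} (hT : IsIrreducibleEnd T)
    (htr : LinearMap.trace (ZMod 2) V T = 1) : IsNilCleanElem T := by
  obtain ⟨n, b, hb⟩ := hT.exists_isShiftedCompanion 0
  have htrace := hb.trace_eq
  simp only [Pi.zero_apply, Finset.sum_const_zero, zero_add, htr] at htrace
  exact hb.isNilCleanElem (fun _ => .zero) htrace.symm fun _ => mul_zero _

theorem IsIrreducibleEnd.isNilCleanElem_of_trace_eq_zero [FiniteDimensional (ZMod 2) V]
    [Nontrivial V] {T : End (ZMod 2) V} (hT : IsIrreducibleEnd T)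
    (htr : LinearMap.trace (ZMod 2) V T = 0) : IsNilCleanElem T := by
  rcases eq_or_ne T 0 with rfl | hT0
  · exact ⟨0, .zero, by rw [sub_zero]; exact .zero⟩
  rcases eq_or_ne T 1 with rfl | hT1
  · exact ⟨1, .one, by rw [sub_self]; exact .zero⟩
  have hsurj := hT.surjective_of_commute hT0 (.refl T)
  have hsurj_sub_one := hT.surjective_of_commute (sub_ne_zero.2 hT1)
    ((Commute.refl T).sub_right (.one_right T))
  obtain ⟨n, b, hb⟩ := hT.exists_isShiftedCompanion (Pi.single 1 1)
  cases n with
  | zero =>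
    refine absurd ?_ (hb.coord_zero_apply_last_ne_zero (by simp) hsurj)
    simpa [htr] using hb.trace_eq.symm
  | succ n => exact hb.isNilCleanElem_of_trace_eq_zero hsurj hsurj_sub_one htr

theorem isNilCleanRing_end_zmod_two (V : Type*) [AddCommGroup V] [Module (ZMod 2) V]
    [FiniteDimensional (ZMod 2) V] : IsNilCleanRing (End (ZMod 2) V) := by
  induction h : finrank (ZMod 2) V using Nat.strong_induction_on generalizing V with
  | _ d ih =>
  intro T
  rcases subsingleton_or_nontrivial V with hV | hV
  · exact ⟨0, .zero, 1, Subsingleton.elim _ _⟩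
  by_cases hT : IsIrreducibleEnd T
  · by_cases htr : LinearMap.trace (ZMod 2) V T = 0
    · exact hT.isNilCleanElem_of_trace_eq_zero htr
    · exact hT.isNilCleanElem_of_trace_eq_one (Fin.eq_one_of_ne_zero _ htr)
  · simp only [IsIrreducibleEnd, not_forall, not_or] at hT
    obtain ⟨W, hW, hbot, htop⟩ := hT
    refine .of_restrict_of_mapQ hW (ih _ ?_ W rfl _) (ih _ ?_ (V ⧸ W) rfl _)
    · exact h ▸ Submodule.finrank_lt htop
    · have hsum := W.finrank_quotient_add_finrank
      have hpos := Submodule.one_le_finrank_iff.2 hbot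
      omega

end ZModTwo

theorem isNilCleanRing_matrix_zmod_two (ι : Type*) [Fintype ι] [DecidableEq ι] :
    IsNilCleanRing (Matrix ι ι (ZMod 2)) :=
  let e := (Matrix.toLinAlgEquiv' (R := ZMod 2) (n := ι)).symm.toRingEquiv
  (isNilCleanRing_end_zmod_two (ι → ZMod 2)).of_surjective e.toRingHom e.surjective

theorem isNilCleanRing_matrix_of_quotient_jacobson {R ι : Type*} [Ring R] [Fintype ι]
    [DecidableEq ι] (e : (R ⧸ Ring.jacobson R) ≃+* ZMod 2)
    (h : IsNilIdeal ((Ring.jacobson R).matrix ι)) : IsNilCleanRing (Matrix ι ι R) := by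
  let g : R →+* ZMod 2 := e.toRingHom.comp (Ideal.Quotient.mk (Ring.jacobson R))
  have hg : Function.Surjective g := e.surjective.comp Ideal.Quotient.mk_surjective
  have hker : RingHom.ker g = Ring.jacobson R := by
    ext x
    rw [RingHom.mem_ker, ← Ideal.Quotient.eq_zero_iff_mem]
    exact e.map_eq_zero_iff
  refine (isNilCleanRing_matrix_zmod_two ι).of_surjective_of_nil_ker g.mapMatrix
    (mapMatrix_surjective hg) fun x hx => h x fun i j => ?_
  rw [← hker]
  exact congrFun (congrFun hx i) j

theorem lemma2p5_general {R ι : Type*} [Ring R] [Nontrivial R] [Fintype ι] [DecidableEq ι]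
    [Nonempty ι] (hR : HasOnlyTrivialIdempotents R) :
    IsNilCleanRing (Matrix ι ι R) ↔
      Nonempty ((R ⧸ Ring.jacobson R) ≃+* ZMod 2) ∧ IsNilIdeal ((Ring.jacobson R).matrix ι) :=
  ⟨fun h => ⟨h.nonempty_quotient_jacobson_ringEquiv_zmod_two hR, h.isNilIdeal_matrix_jacobson⟩,
    fun ⟨⟨e⟩, h⟩ => isNilCleanRing_matrix_of_quotient_jacobson e h⟩

theorem lemma2p5 {R : Type*} [Ring R] [Nontrivial R] (hR : HasOnlyTrivialIdempotents R)
    (n : ℕ) (hn : 1 ≤ n) :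
    IsNilCleanRing (Matrix (Fin n) (Fin n) R) ↔
      Nonempty ((R ⧸ Ring.jacobson R) ≃+* ZMod 2) ∧
        IsNilIdeal ((Ring.jacobson R).matrix (Fin n)) := by
  have : Nonempty (Fin n) := ⟨⟨0, hn⟩⟩
  exact lemma2p5_general hR
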